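/- For $n\in\mathbb{N}$ let $Q_n$ be the $n$-dimensional hypercube, that is, the graph whose vertices are the subsets of $\{1,\dots,n\}$, two of them being adjacent if and only if their symmetric difference has exactly one element. A set $M$ of vertices of a graph $G$ is a mutual-visibility set if for any two vertices $u,v\in M$ there is a shortest $u,v$-path in $G$ that contains no vertex of $M\setminus\{u,v\}$. The chromatic mutual-visibility number $\chi_\mu(G)$ is the smallest number of colours in a (not necessarily proper) vertex-colouring of $G$ such that every colour class is a mutual-visibility set. Theorem. As $n\to\infty$, $$\chi_\mu(Q_n)\to\infty \qquad\text{and}\qquad \chi_\mu(Q_n)=O(\log\log n).$$ In particular, there is no absolute constant $C>0$ such that $\chi_\mu(Q_n)\le C$ for all $n\ge 1$. -/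

import Mathlib

open Filter Asymptotics

namespace MutualVisibility

/-- Two vertices `u` and `v` of `G` are `M`-visible if some shortest `u`,`v`-path of `G` contains
no vertex of `M` other than `u` and `v`. -/
def Visible {V : Type*} (G : SimpleGraph V) (M : Set V) (u v : V) : Prop :=
  ∃ p : G.Walk u v, p.IsPath ∧ p.length = G.dist u v ∧
    ∀ w ∈ p.support, w ∈ M → w = u ∨ w = v

/-- `M` is a mutual-visibility set of `G` if any two vertices of `M` are `M`-visible. -/
def IsMutualVisibilitySet {V : Type*} (G : SimpleGraph V) (M : Set V) : Prop :=
  ∀ u ∈ M, ∀ v ∈ M, Visible G M u v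

/-- `G` has a vertex-colouring with colours from `Fin k` (no properness is required) all of whose
colour classes are mutual-visibility sets. -/
def IsColorable {V : Type*} (G : SimpleGraph V) (k : ℕ) : Prop :=
  ∃ c : V → Fin k, ∀ i : Fin k, IsMutualVisibilitySet G {v | c v = i}

/-- The chromatic mutual-visibility number `χ_μ(G)`: the smallest number of colours in a
vertex-colouring of `G` all of whose colour classes are mutual-visibility sets. For a finite graph
the minimum is attained, see `isLeast_chromaticNumber`. -/
noncomputable def chromaticNumber {V : Type*} (G : SimpleGraph V) : ℕ :=
  sInf {k : ℕ | IsColorable G k}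

/-- On a finite graph the infimum that defines the chromatic mutual-visibility number is a
minimum: giving each vertex its own colour is always allowed. -/
theorem isLeast_chromaticNumber {V : Type*} [Finite V] (G : SimpleGraph V) :
    IsLeast {k : ℕ | IsColorable G k} (chromaticNumber G) := by
  refine ⟨Nat.sInf_mem ⟨Nat.card V, Finite.equivFin V, ?_⟩, fun k hk => Nat.sInf_le hk⟩
  intro i u hu v hv
  obtain rfl : u = v := (Finite.equivFin V).injective
    ((show Finite.equivFin V u = i from hu).trans (show Finite.equivFin V v = i from hv).symm)
  exact ⟨SimpleGraph.Walk.nil, by simp, by simp, by simp⟩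

/-- The `n`-dimensional hypercube `Q_n`: its vertices are the subsets of an `n`-element set, and
two of them are adjacent if and only if their symmetric difference has exactly one element. -/
def hypercube (n : ℕ) : SimpleGraph (Finset (Fin n)) where
  Adj A B := (symmDiff A B).card = 1
  symm := ⟨fun A B h => by rw [symmDiff_comm]; exact h⟩
  loopless := ⟨fun A h => by simp at h⟩

end MutualVisibility

/-! Lower bound. For `k` colours and large `n`, iterated Ramsey (`exists_layered_subset`) gives a
`2k`-set `Y` on whose subsets the colour depends only on size. Three of the `2k + 1` sizes share a
colour. A geodesic between nested subsets of `Y` of the smallest and largest of these sizes crosses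
the middle level inside `Y`, so it is blocked.

Upper bound. Colour a set by its size mod `p` and one bit. The residue leaves `p - 1` free levels
between consecutive levels of a class, enough to join sets whose sizes differ by `0` or `p`. For
sizes further apart, the geodesic from `u` to `v` crosses an occupied level at some `u ∪ P` with the
other bit, where `P` is a `p`-subset of a `2p`-set `T ⊆ v \ u` (`Linked.of_daisy_free`). Such a bit
exists by a union bound (`exists_daisy_coloring`). Letting it depend only on the first `2p` power
sums cuts the number of constraints from exponential in `n` to `n ^ O(p²)`, while each still
involves at least `4 ^ p / (2p)` distinct values. So `p` of order `log log n` suffices. -/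

namespace MutualVisibility

/-! ### Hypergraph Ramsey theorem -/

section Ramsey

variable {α : Type*} [LinearOrder α]

/-- One step of the Erdős–Rado argument: a large set contains a set of size `t` on which the colour
of an `(r + 1)`-subset is determined by its minimum. -/
theorem exists_min_determined {k r : ℕ}
    (ih : ∀ m, ∃ N, ∀ X : Finset α, N ≤ X.card → ∀ c : Finset α → Fin k, ∃ Y ⊆ X, Y.card = m ∧
      ∀ A ⊆ Y, ∀ B ⊆ Y, A.card = r → B.card = r → c A = c B) (t : ℕ) :
    ∃ N, ∀ X : Finset α, N ≤ X.card → ∀ c : Finset α → Fin k, ∃ Y ⊆ X, Y.card = t ∧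
      ∀ A ⊆ Y, ∀ B ⊆ Y, A.card = r + 1 → B.card = r + 1 → A.min = B.min → c A = c B := by
  induction t with
  | zero =>
    refine ⟨0, fun X _ c => ⟨∅, by simp, by simp, fun A hA B _ hAc => ?_⟩⟩
    simp [Finset.subset_empty.mp hA] at hAc
  | succ t iht =>
    obtain ⟨N, hN⟩ := iht
    obtain ⟨N', hN'⟩ := ih N
    refine ⟨N' + 1, fun X hX c => ?_⟩
    have hne : X.Nonempty := Finset.card_pos.mp (by omega)
    set x := X.min' hne with hx
    have hxX : x ∈ X := X.min'_mem hne
    -- Sets with minimum `x` are settled by making `A ↦ c (insert x A)` constant on `r`-sets; the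
    -- others lie in `Y ⊆ Y'` and fall to induction.
    obtain ⟨Y', hY'X, hY'c, hY'⟩ := hN' (X.erase x)
      (by rw [Finset.card_erase_of_mem hxX]; omega) (fun A => c (insert x A))
    obtain ⟨Y, hYY', hYc, hY⟩ := hN Y' hY'c.ge c
    have hxY : x ∉ Y := fun h => Finset.notMem_erase x X (hY'X (hYY' h))
    have hsub : insert x Y ⊆ X := Finset.insert_subset hxX
      (hYY'.trans (hY'X.trans (Finset.erase_subset _ _)))
    refine ⟨insert x Y, hsub, by rw [Finset.card_insert_of_notMem hxY, hYc], ?_⟩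
    have hmin : ∀ A ⊆ insert x Y, x ∈ A → A.min = x := fun A hA hxA =>
      le_antisymm (Finset.min_le hxA)
        (Finset.le_min fun a ha => WithTop.coe_le_coe.mpr (X.min'_le a (hsub (hA ha))))
    have key : ∀ A ⊆ insert x Y, ∀ B ⊆ insert x Y, A.card = r + 1 → B.card = r + 1 →
        A.min = B.min → x ∈ A → c A = c B := by
      intro A hA B hB hAc hBc hAB hxA
      have hxB : x ∈ B := Finset.mem_of_min (hAB ▸ hmin A hA hxA)
      have h := hY' (A.erase x) ((Finset.subset_insert_iff.mp hA).trans hYY')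
        (B.erase x) ((Finset.subset_insert_iff.mp hB).trans hYY')
        (by rw [Finset.card_erase_of_mem hxA]; omega) (by rw [Finset.card_erase_of_mem hxB]; omega)
      simpa [Finset.insert_erase hxA, Finset.insert_erase hxB] using h
    intro A hA B hB hAc hBc hAB
    by_cases hxA : x ∈ A
    · exact key A hA B hB hAc hBc hAB hxA
    by_cases hxB : x ∈ B
    · exact (key B hB A hA hBc hAc hAB.symm hxB).symm
    · exact hY A ((Finset.subset_insert_iff_of_notMem hxA).mp hA)
        B ((Finset.subset_insert_iff_of_notMem hxB).mp hB) hAc hBc hAB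

/-- Ramsey's theorem for `r`-uniform hypergraphs and `k` colours. -/
theorem exists_monochromatic_subset (k r : ℕ) : ∀ m, ∃ N, ∀ X : Finset α, N ≤ X.card →
    ∀ c : Finset α → Fin k, ∃ Y ⊆ X, Y.card = m ∧
      ∀ A ⊆ Y, ∀ B ⊆ Y, A.card = r → B.card = r → c A = c B := by
  induction r with
  | zero =>
    refine fun m => ⟨m, fun X hX c => ?_⟩
    obtain ⟨Y, hYX, hY⟩ := Finset.exists_subset_card_eq hX
    refine ⟨Y, hYX, hY, fun A _ B _ hA hB => ?_⟩
    rw [Finset.card_eq_zero.mp hA, Finset.card_eq_zero.mp hB]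
  | succ r ih =>
    intro m
    obtain ⟨N, hN⟩ := exists_min_determined ih (k * m + 1)
    refine ⟨N, fun X hX c => ?_⟩
    obtain ⟨Z, hZX, hZc, hZ⟩ := hN X hX c
    classical
    -- The value `c ∅` is a dummy for points that are not the minimum of any `(r + 1)`-subset of
    -- `Z`.
    let g : α → Fin k := fun y =>
      if h : ∃ A ⊆ Z, A.card = r + 1 ∧ A.min = y then c h.choose else c ∅
    obtain ⟨i, -, hi⟩ := Finset.exists_lt_card_fiber_of_mul_lt_card_of_maps_to
      (s := Z) (t := Finset.univ) (f := g) (n := m) (fun _ _ => Finset.mem_univ _)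
      (by rw [Finset.card_univ, Fintype.card_fin]; omega)
    obtain ⟨Y, hYZ, hY⟩ := Finset.exists_subset_card_eq hi.le
    have hYZ' : Y ⊆ Z := hYZ.trans (Finset.filter_subset _ _)
    have key : ∀ A ⊆ Y, A.card = r + 1 → c A = i := by
      intro A hA hAc
      have hne : A.Nonempty := Finset.card_pos.mp (by omega)
      have hex : ∃ B ⊆ Z, B.card = r + 1 ∧ B.min = A.min' hne :=
        ⟨A, hA.trans hYZ', hAc, (Finset.coe_min' hne).symm⟩
      have hg : g (A.min' hne) = i := (Finset.mem_filter.mp (hYZ (hA (A.min'_mem hne)))).2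
      rw [← hg]
      simp only [g, dif_pos hex]
      refine hZ A (hA.trans hYZ') _ hex.choose_spec.1 hAc hex.choose_spec.2.1 ?_
      rw [hex.choose_spec.2.2, Finset.coe_min']
    exact ⟨Y, hYZ'.trans hZX, hY, fun A hA B hB hAc hBc => (key A hA hAc).trans (key B hB hBc).symm⟩

/-- A large set contains a set of size `m` on whose subsets of size less than `t` the colour depends
only on the size. -/
theorem exists_layered_subset (k m t : ℕ) : ∃ N, ∀ X : Finset α, N ≤ X.card →
    ∀ c : Finset α → Fin k, ∃ Y ⊆ X, Y.card = m ∧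
      ∀ A ⊆ Y, ∀ B ⊆ Y, A.card < t → A.card = B.card → c A = c B := by
  induction t with
  | zero =>
    refine ⟨m, fun X hX c => ?_⟩
    obtain ⟨Y, hYX, hY⟩ := Finset.exists_subset_card_eq hX
    exact ⟨Y, hYX, hY, fun A _ B _ hA => absurd hA (Nat.not_lt_zero _)⟩
  | succ t ih =>
    obtain ⟨N, hN⟩ := ih
    obtain ⟨N', hN'⟩ := exists_monochromatic_subset (α := α) k t N
    refine ⟨N', fun X hX c => ?_⟩
    obtain ⟨Z, hZX, hZc, hZ⟩ := hN' X hX c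
    obtain ⟨Y, hYZ, hYc, hY⟩ := hN Z hZc.ge c
    refine ⟨Y, hYZ.trans hZX, hYc, fun A hA B hB hAt hAB => ?_⟩
    rcases Nat.lt_succ_iff_lt_or_eq.mp hAt with h | h
    · exact hY A hA B hB h hAB
    · exact hZ A (hA.trans hYZ) B (hB.trans hYZ) h (hAB ▸ h)

end Ramsey

/-- Ramsey is applied in `ℕ` and pulled back, so that the threshold `N` does not depend on `n`. -/
theorem exists_layered_subset_fin (k m t : ℕ) : ∃ N, ∀ n, N ≤ n → ∀ c : Finset (Fin n) → Fin k,
    ∃ Y : Finset (Fin n), Y.card = m ∧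
      ∀ A ⊆ Y, ∀ B ⊆ Y, A.card < t → A.card = B.card → c A = c B := by
  obtain ⟨N, hN⟩ := exists_layered_subset (α := ℕ) k m t
  refine ⟨N, fun n hn c => ?_⟩
  obtain ⟨Y, hYX, hYc, hY⟩ := hN (Finset.range n) (by simpa using hn)
    (fun S => c (Finset.univ.filter fun i : Fin n => (i : ℕ) ∈ S))
  obtain ⟨Z, rfl⟩ : ∃ Z : Finset (Fin n), Z.map Fin.valEmbedding = Y := by
    refine ⟨Finset.univ.filter fun i : Fin n => (i : ℕ) ∈ Y, ?_⟩
    ext a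
    simp only [Finset.mem_map, Finset.mem_filter, Finset.mem_univ, true_and, Fin.valEmbedding_apply]
    exact ⟨by rintro ⟨i, hi, rfl⟩; exact hi, fun ha => ⟨⟨a, Finset.mem_range.mp (hYX ha)⟩, ha, rfl⟩⟩
  refine ⟨Z, by simpa using hYc, fun A hA B hB hAt hAB => ?_⟩
  have h := hY (A.map Fin.valEmbedding) (Finset.map_subset_map.mpr hA) (B.map Fin.valEmbedding)
    (Finset.map_subset_map.mpr hB) (by simpa using hAt) (by simpa using hAB)
  simpa [Fin.val_inj] using h

/-! ### Geodesics of the hypercube -/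

section Hypercube

variable {n : ℕ}

theorem card_symmDiff_le (u v w : Finset (Fin n)) :
    (symmDiff u w).card ≤ (symmDiff u v).card + (symmDiff v w).card :=
  (Finset.card_le_card (symmDiff_triangle u v w)).trans (Finset.card_union_le _ _)

theorem card_symmDiff_le_length {u v : Finset (Fin n)} (p : (hypercube n).Walk u v) :
    (symmDiff u v).card ≤ p.length := by
  induction p with
  | nil => simp
  | @cons a b d h q ih =>
    have h' : (symmDiff a b).card = 1 := h
    have := card_symmDiff_le a b d
    rw [SimpleGraph.Walk.length_cons]
    omega

/-- `u` and `v` are joined by a walk of length `|u ∆ v|` which avoids `M` inside. -/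
def Linked (M : Set (Finset (Fin n))) (u v : Finset (Fin n)) : Prop :=
  ∃ p : (hypercube n).Walk u v, p.length = (symmDiff u v).card ∧
    ∀ w ∈ p.support, w ∈ M → w = u ∨ w = v

variable {M : Set (Finset (Fin n))} {u v w : Finset (Fin n)}

theorem Linked.refl (M : Set (Finset (Fin n))) (u : Finset (Fin n)) : Linked M u u :=
  ⟨SimpleGraph.Walk.nil, by simp, by simp⟩

theorem Linked.of_card_eq_one (h : (symmDiff u v).card = 1) : Linked M u v :=
  ⟨SimpleGraph.Walk.cons (show (hypercube n).Adj u v from h) SimpleGraph.Walk.nil,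
    by simp [h], by simp⟩

theorem Linked.symm (h : Linked M u v) : Linked M v u := by
  obtain ⟨p, hp, hM⟩ := h
  refine ⟨p.reverse, by rw [SimpleGraph.Walk.length_reverse, hp, symmDiff_comm], fun w hw hwM => ?_⟩
  exact (hM w (by simpa using hw) hwM).symm

theorem Linked.trans (huw : Linked M u w) (hwv : Linked M w v) (hw : w ∉ M)
    (hd : (symmDiff u w).card + (symmDiff w v).card = (symmDiff u v).card) : Linked M u v := by
  obtain ⟨p, hp, hpM⟩ := huw
  obtain ⟨q, hq, hqM⟩ := hwv
  refine ⟨p.append q, by rw [SimpleGraph.Walk.length_append, hp, hq, hd], fun x hx hxM => ?_⟩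
  rcases (SimpleGraph.Walk.mem_support_append_iff p q).mp hx with h | h
  · exact (hpM x h hxM).imp_right fun e => absurd (e ▸ hxM) hw
  · exact (hqM x h hxM).imp_left fun e => absurd (e ▸ hxM) hw

theorem card_symmDiff_insert {x : Fin n} (hx : x ∈ v) (hxu : x ∉ u) :
    (symmDiff u (insert x u)).card = 1 ∧
      (symmDiff (insert x u) v).card + 1 = (symmDiff u v).card := by
  have h1 : symmDiff u (insert x u) = {x} := by
    ext a; simp only [Finset.mem_symmDiff, Finset.mem_insert, Finset.mem_singleton]; grind
  have h2 : symmDiff (insert x u) v = (symmDiff u v).erase x := by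
    ext a; simp only [Finset.mem_symmDiff, Finset.mem_insert, Finset.mem_erase]; grind
  refine ⟨by rw [h1, Finset.card_singleton], ?_⟩
  rw [h2, Finset.card_erase_add_one]
  exact Finset.mem_symmDiff.mpr (Or.inr ⟨hx, hxu⟩)

theorem card_symmDiff_erase {x : Fin n} (hx : x ∈ u) (hxv : x ∉ v) :
    (symmDiff u (u.erase x)).card = 1 ∧
      (symmDiff (u.erase x) v).card + 1 = (symmDiff u v).card := by
  have h1 : symmDiff u (u.erase x) = {x} := by
    ext a; simp only [Finset.mem_symmDiff, Finset.mem_erase, Finset.mem_singleton]; grind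
  have h2 : symmDiff (u.erase x) v = (symmDiff u v).erase x := by
    ext a; simp only [Finset.mem_symmDiff, Finset.mem_erase]; grind
  refine ⟨by rw [h1, Finset.card_singleton], ?_⟩
  rw [h2, Finset.card_erase_add_one]
  exact Finset.mem_symmDiff.mpr (Or.inl ⟨hx, hxv⟩)

theorem Linked.of_insert {x : Fin n} (hx : x ∈ v) (hxu : x ∉ u) (hM : insert x u ∉ M)
    (h : Linked M (insert x u) v) : Linked M u v :=
  (Linked.of_card_eq_one (card_symmDiff_insert hx hxu).1).trans h hM (by
    have := card_symmDiff_insert hx hxu; omega)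

theorem Linked.of_erase {x : Fin n} (hx : x ∈ u) (hxv : x ∉ v) (hM : u.erase x ∉ M)
    (h : Linked M (u.erase x) v) : Linked M u v :=
  (Linked.of_card_eq_one (card_symmDiff_erase hx hxv).1).trans h hM (by
    have := card_symmDiff_erase hx hxv; omega)

/-- Inside a strip of at least two consecutive levels that avoid `M`, any two vertices are linked. -/
theorem Linked.of_mem_strip {a b : ℕ} (hab : a < b) (hM : ∀ w ∈ M, ¬ (a ≤ w.card ∧ w.card ≤ b))
    (v : Finset (Fin n)) (hv : a ≤ v.card ∧ v.card ≤ b) :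
    ∀ u : Finset (Fin n), a ≤ u.card ∧ u.card ≤ b → Linked M u v := by
  suffices H : ∀ d, ∀ u : Finset (Fin n), (symmDiff u v).card = d → a ≤ u.card ∧ u.card ≤ b →
      Linked M u v from fun u hu => H _ u rfl hu
  intro d
  induction d with
  | zero =>
    intro u hd _
    rw [symmDiff_eq_bot.mp (Finset.card_eq_zero.mp hd)]
    exact Linked.refl M v
  | succ d ih =>
    intro u hd hu
    have hne : u ≠ v := by rintro rfl; simp at hd
    -- Step towards `v`, upwards if possible, else downwards; since `a < b`, both moves fail only
    -- when `u = v`.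
    by_cases hup : u.card < b ∧ ¬ v ⊆ u
    · obtain ⟨x, hxv, hxu⟩ := Finset.not_subset.mp hup.2
      have hc := Finset.card_insert_of_notMem hxu
      have hd' := card_symmDiff_insert hxv hxu
      have hs : a ≤ (insert x u).card ∧ (insert x u).card ≤ b := by omega
      exact Linked.of_insert hxv hxu (fun h => hM _ h hs) (ih _ (by omega) hs)
    by_cases hdown : a < u.card ∧ ¬ u ⊆ v
    · obtain ⟨x, hxu, hxv⟩ := Finset.not_subset.mp hdown.2
      have hc := Finset.card_erase_of_mem hxu
      have hd' := card_symmDiff_erase hxu hxv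
      have hs : a ≤ (u.erase x).card ∧ (u.erase x).card ≤ b := by omega
      exact Linked.of_erase hxu hxv (fun h => hM _ h hs) (ih _ (by omega) hs)
    exfalso
    rcases not_and_or.mp hup with h1 | h1
    · rcases not_and_or.mp hdown with h2 | h2
      · omega
      · exact hne (Finset.eq_of_subset_of_card_le (not_not.mp h2) (by omega))
    · rcases not_and_or.mp hdown with h2 | h2
      · exact hne (Finset.eq_of_subset_of_card_le (not_not.mp h1) (by omega)).symm
      · exact hne ((not_not.mp h2).antisymm (not_not.mp h1))

theorem dist_hypercube (u v : Finset (Fin n)) :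
    (hypercube n).dist u v = (symmDiff u v).card := by
  obtain ⟨p, hp, -⟩ : Linked (∅ : Set (Finset (Fin n))) u v :=
    -- The top is `n + 1` so that the strip has two levels even for `n = 0`.
    Linked.of_mem_strip (a := 0) (b := n + 1) (by omega) (by simp) v
      ⟨Nat.zero_le _, (card_finset_fin_le v).trans n.le_succ⟩ u
      ⟨Nat.zero_le _, (card_finset_fin_le u).trans n.le_succ⟩
  obtain ⟨q, hq⟩ := p.reachable.exists_walk_length_eq_dist
  exact le_antisymm (hp ▸ SimpleGraph.dist_le p) (hq ▸ card_symmDiff_le_length q)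

theorem Linked.visible (h : Linked M u v) : Visible (hypercube n) M u v := by
  obtain ⟨p, hp, hM⟩ := h
  rw [← dist_hypercube] at hp
  exact ⟨p, p.isPath_of_length_eq_dist hp, hp, hM⟩

/-- A walk from a smaller to a larger set meets every level in between. -/
theorem exists_mem_support_card_eq (p : (hypercube n).Walk u v) {s : ℕ} (hu : u.card ≤ s)
    (hv : s ≤ v.card) : ∃ w ∈ p.support, w.card = s := by
  induction p with
  | nil => exact ⟨_, by simp, le_antisymm hu hv⟩
  | @cons a b d h q ih =>
    rcases hu.eq_or_lt with h' | h'
    · exact ⟨a, by simp, h'⟩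
    · have hab : (symmDiff a b).card = 1 := h
      have hb : b.card ≤ a.card + 1 := by
        have h1 : b ⊆ a ∪ symmDiff a b := by
          intro x hx; simp only [Finset.mem_union, Finset.mem_symmDiff]; tauto
        have := (Finset.card_le_card h1).trans (Finset.card_union_le _ _)
        omega
      obtain ⟨w, hw, hws⟩ := ih (by omega) hv
      exact ⟨w, by simp [hw], hws⟩

/-- The vertices of a geodesic from `u` to a superset `v` are subsets of `v`. -/
theorem subset_of_mem_support (huv : u ⊆ v) (p : (hypercube n).Walk u v)
    (hp : p.length = (symmDiff u v).card) (hw : w ∈ p.support) : w ⊆ v := by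
  have h1 := card_symmDiff_le_length (p.takeUntil w hw)
  have h2 := card_symmDiff_le_length (p.dropUntil w hw)
  have h3 : (p.takeUntil w hw).length + (p.dropUntil w hw).length = p.length := by
    rw [← SimpleGraph.Walk.length_append, SimpleGraph.Walk.take_spec]
  have h4 : (symmDiff u v).card ≤ ((symmDiff u w) ∪ (symmDiff w v)).card :=
    Finset.card_le_card (symmDiff_triangle u w v)
  have h5 := Finset.card_union_add_card_inter (symmDiff u w) (symmDiff w v)
  -- A geodesic flips no element twice, whereas an element of `w \ v` would be added and later
  -- removed.
  have h6 : symmDiff u w ∩ symmDiff w v = ∅ := Finset.card_eq_zero.mp (by omega)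
  intro x hx
  by_contra hxv
  have : x ∈ symmDiff u w ∩ symmDiff w v := by
    have := fun h => hxv (huv h)
    simp only [Finset.mem_inter, Finset.mem_symmDiff]; tauto
  simp [h6] at this

/-! ### Lower bound -/

/-- If the colour of a subset of `Y` depends only on its size and three sizes share a colour, then
the colour classes are not all mutual-visibility sets. -/
theorem not_isColorable_of_layered {k : ℕ} (c : Finset (Fin n) → Fin k) (Y : Finset (Fin n))
    (hYc : Y.card = 2 * k)
    (hY : ∀ A ⊆ Y, ∀ B ⊆ Y, A.card < 2 * k + 1 → A.card = B.card → c A = c B) :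
    ¬ ∀ i : Fin k, IsMutualVisibilitySet (hypercube n) {v | c v = i} := by
  intro hc
  have hex : ∀ r : Fin (2 * k + 1), ∃ A ⊆ Y, A.card = r := fun r =>
    Finset.exists_subset_card_eq (by have := r.2; omega)
  choose S hS hSc using hex
  obtain ⟨i, -, hi⟩ := Finset.exists_lt_card_fiber_of_mul_lt_card_of_maps_to
    (s := (Finset.univ : Finset (Fin (2 * k + 1)))) (t := Finset.univ) (f := fun r => c (S r))
    (n := 2) (fun _ _ => Finset.mem_univ _)
    (by simp only [Finset.card_univ, Fintype.card_fin]; omega)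
  set F := Finset.univ.filter fun r => c (S r) = i with hF
  obtain ⟨r, s, t, hr, hs, ht, hrs, hst⟩ :
      ∃ r s t, r ∈ F ∧ s ∈ F ∧ t ∈ F ∧ r < s ∧ s < t := by
    let e := F.orderEmbOfFin rfl
    refine ⟨e ⟨0, by omega⟩, e ⟨1, by omega⟩, e ⟨2, by omega⟩, F.orderEmbOfFin_mem rfl _,
      F.orderEmbOfFin_mem rfl _, F.orderEmbOfFin_mem rfl _, ?_, ?_⟩ <;>
    · rw [OrderEmbedding.lt_iff_lt]; simp
  -- Choosing `A` inside `S t` keeps the geodesic among subsets of `Y`.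
  obtain ⟨A, hAt, hAc⟩ := Finset.exists_subset_card_eq
    (show (r : ℕ) ≤ (S t).card by rw [hSc]; exact (hrs.trans hst).le)
  have hAY := hAt.trans (hS t)
  have hcA : c A = i := (hY A hAY (S r) (hS r) (by rw [hAc]; exact r.2)
    (by rw [hAc, hSc])).trans (Finset.mem_filter.mp hr).2
  obtain ⟨p, -, hp, hpM⟩ := hc i A hcA (S t) (Finset.mem_filter.mp ht).2
  obtain ⟨w, hw, hws⟩ := exists_mem_support_card_eq p (s := s) (by rw [hAc]; exact hrs.le)
    (by rw [hSc]; exact hst.le)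
  have hwt := subset_of_mem_support hAt p (hp.trans (dist_hypercube _ _)) hw
  have hcw : c w = i := (hY w (hwt.trans (hS t)) (S s) (hS s) (by rw [hws]; exact s.2)
    (by rw [hws, hSc])).trans (Finset.mem_filter.mp hs).2
  have hrs' : (r : ℕ) < s := hrs
  have hst' : (s : ℕ) < t := hst
  rcases hpM w hw hcw with rfl | rfl
  · omega
  · have := hSc t; omega

theorem tendsto_chromaticNumber_hypercube :
    Tendsto (fun n : ℕ => chromaticNumber (hypercube n)) atTop atTop := by
  refine tendsto_atTop.mpr fun k => ?_
  obtain ⟨N, hN⟩ := exists_layered_subset_fin k (2 * k) (2 * k + 1)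
  filter_upwards [eventually_ge_atTop N] with n hn
  by_contra! hlt
  obtain ⟨c, hc⟩ := (isLeast_chromaticNumber (hypercube n)).1
  -- The colouring is padded to `k` colours; unused colours have empty classes.
  obtain ⟨Y, hYc, hY⟩ := hN n hn fun v => Fin.castLE hlt.le (c v)
  refine not_isColorable_of_layered _ Y hYc hY fun i => ?_
  by_cases hi : ∃ j, Fin.castLE hlt.le j = i
  · obtain ⟨j, rfl⟩ := hi
    simpa [Fin.castLE_inj] using hc j
  · exact fun u hu => absurd ⟨_, hu⟩ hi

end Hypercube

/-! ### Daisy-free two-colourings -/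

section Daisies

/-- A `B`-uniform hypergraph with fewer than `2 ^ (B - 1)` edges has property B. -/
theorem exists_two_coloring {α : Type*} [DecidableEq α] (H : Finset (Finset α)) {B : ℕ}
    (hB : ∀ e ∈ H, e.card = B) (hH : H.card * 2 < 2 ^ B) :
    ∃ U : Finset α, ∀ e ∈ H, (∃ x ∈ e, x ∉ U) ∧ ∃ x ∈ e, x ∈ U := by
  rcases H.eq_empty_or_nonempty with rfl | ⟨e₀, he₀⟩
  · exact ⟨∅, by simp⟩
  set X := H.biUnion id with hX
  have hsub : ∀ e ∈ H, e ⊆ X := fun e he => Finset.subset_biUnion_of_mem id he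
  have hBX : B ≤ X.card := hB e₀ he₀ ▸ Finset.card_le_card (hsub e₀ he₀)
  -- For each edge, `2 ^ (|X| - B)` subsets of `X` contain it and as many miss it.
  have hbad : (H.biUnion fun e => Finset.Icc e X ∪ (X \ e).powerset).card < X.powerset.card := by
    calc (H.biUnion fun e => Finset.Icc e X ∪ (X \ e).powerset).card
        ≤ H.card * (2 * 2 ^ (X.card - B)) := by
          refine Finset.card_biUnion_le_card_mul _ _ _ fun e he =>
            (Finset.card_union_le _ _).trans ?_
          rw [Finset.card_Icc_finset (hsub e he), Finset.card_powerset,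
            Finset.card_sdiff_of_subset (hsub e he), hB e he, two_mul]
      _ = H.card * 2 * 2 ^ (X.card - B) := by ring
      _ < 2 ^ B * 2 ^ (X.card - B) := Nat.mul_lt_mul_of_pos_right hH (by positivity)
      _ = X.powerset.card := by rw [← pow_add, Nat.add_sub_cancel' hBX, Finset.card_powerset]
  obtain ⟨U, hUX, hU⟩ := Finset.exists_mem_notMem_of_card_lt_card hbad
  rw [Finset.mem_powerset] at hUX
  refine ⟨U, fun e he => ⟨?_, ?_⟩⟩
  · by_contra! h
    exact hU (Finset.mem_biUnion.mpr ⟨e, he, Finset.mem_union_left _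
      (Finset.mem_Icc.mpr ⟨h, hUX⟩)⟩)
  · by_contra! h
    exact hU (Finset.mem_biUnion.mpr ⟨e, he, Finset.mem_union_right _
      (Finset.mem_powerset.mpr fun x hx => Finset.mem_sdiff.mpr ⟨hUX hx, fun hxe => h x hxe hx⟩)⟩)

/-- The first `q` power sums of a set of natural numbers less than `n`. -/
def powerSums {n : ℕ} (q : ℕ) (A : Finset (Fin n)) : Fin q → ℕ :=
  fun j => ∑ i ∈ A, (i : ℕ) ^ (j : ℕ)

variable {n q : ℕ}

theorem powerSums_union {S P : Finset (Fin n)} (h : Disjoint S P) :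
    powerSums q (S ∪ P) = powerSums q S + powerSums q P := by
  ext j
  exact Finset.sum_union h

theorem powerSums_le (A : Finset (Fin n)) (j : Fin q) : powerSums q A j ≤ n ^ q := by
  rcases n.eq_zero_or_pos with rfl | hn
  · simp [powerSums, Finset.eq_empty_of_isEmpty A]
  calc powerSums q A j ≤ A.card • n ^ (j : ℕ) :=
        Finset.sum_le_card_nsmul _ _ _ fun i _ => Nat.pow_le_pow_left i.2.le _
    _ ≤ n * n ^ (j : ℕ) := Nat.mul_le_mul_right _ (card_finset_fin_le A)
    _ = n ^ ((j : ℕ) + 1) := (pow_succ' _ _).symm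
    _ ≤ n ^ q := Nat.pow_le_pow_right hn j.2

/-- Vandermonde: the difference of the two indicator vectors on the `q` distinct points of `T` is
orthogonal to the first `q` powers, hence zero. -/
theorem powerSums_injOn {T : Finset (Fin n)} (hT : T.card = q) :
    Set.InjOn (powerSums (n := n) q) {P | P ⊆ T} := by
  intro P hP P' hP' h
  let e := T.orderEmbOfFin hT
  have hsum : ∀ R ⊆ T, ∀ i : Fin q,
      (∑ j : Fin q, (if e j ∈ R then (1 : ℤ) else 0) * ((e j : ℕ) : ℤ) ^ (i : ℕ)) =
        (powerSums q R i : ℤ) := by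
    intro R hR i
    have h1 := Finset.sum_map Finset.univ e.toEmbedding
      fun x : Fin n => (if x ∈ R then (1 : ℤ) else 0) * ((x : ℕ) : ℤ) ^ (i : ℕ)
    rw [Finset.map_orderEmbOfFin_univ] at h1
    refine h1.symm.trans ?_
    simp only [ite_mul, one_mul, zero_mul]
    rw [← Finset.sum_filter, Finset.filter_mem_eq_inter, Finset.inter_eq_right.mpr hR]
    simp [powerSums]
  have hv := Matrix.eq_zero_of_forall_pow_sum_mul_pow_eq_zero (R := ℤ)
    (f := fun j : Fin q => ((e j : ℕ) : ℤ))
    (v := fun j => (if e j ∈ P then (1 : ℤ) else 0) - (if e j ∈ P' then (1 : ℤ) else 0))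
    (fun a b hab => e.injective (Fin.val_injective (Int.ofNat_inj.mp hab)))
    (fun i => by
      simp only [sub_mul, Finset.sum_sub_distrib]
      rw [hsum P hP, hsum P' hP', h, sub_self])
  ext x
  by_cases hx : x ∈ T
  · obtain ⟨j, rfl⟩ : ∃ j, e j = x := by
      have : x ∈ Set.range (T.orderEmbOfFin hT) := by rw [Finset.range_orderEmbOfFin]; exact hx
      exact this
    have := congrFun hv j
    by_cases h1 : e j ∈ P <;> by_cases h2 : e j ∈ P' <;> simp [h1, h2] at this ⊢
  · exact ⟨fun h => absurd (hP h) hx, fun h => absurd (hP' h) hx⟩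

/-- A two-colouring of the subsets of an `n`-element set without monochromatic daisies whose
stem is arbitrary and whose petals are the `p`-subsets of a `2p`-set. -/
theorem exists_daisy_coloring {p : ℕ}
    (h : (n ^ (2 * p) + 1) ^ (2 * p) * n ^ (2 * p) * 2 < 2 ^ p.centralBinom) :
    ∃ f : Finset (Fin n) → Bool, ∀ S T : Finset (Fin n), Disjoint S T → T.card = 2 * p →
      ∀ b, ∃ P ⊆ T, P.card = p ∧ f (S ∪ P) ≠ b := by
  classical
  -- Stems enter only through their power sums, so all bounded vectors stand in for them.
  let I := (Fintype.piFinset fun _ : Fin (2 * p) => Finset.range (n ^ (2 * p) + 1)) ×ˢ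
    Finset.powersetCard (2 * p) (Finset.univ : Finset (Fin n))
  let E : (Fin (2 * p) → ℕ) × Finset (Fin n) → Finset (Fin (2 * p) → ℕ) := fun a =>
    (Finset.powersetCard p a.2).image fun P => a.1 + powerSums (2 * p) P
  obtain ⟨U, hU⟩ := exists_two_coloring (I.image E) (B := p.centralBinom)
    (by
      intro e he
      obtain ⟨⟨s, T⟩, ha, rfl⟩ := Finset.mem_image.mp he
      have hT := (Finset.mem_powersetCard.mp (Finset.mem_product.mp ha).2).2
      have hinj : Set.InjOn (fun P => s + powerSums (2 * p) P)
          (Finset.powersetCard p T : Set (Finset (Fin n))) := by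
        intro P hP P' hP' hPP
        exact powerSums_injOn hT (Finset.mem_powersetCard.mp (Finset.mem_coe.mp hP)).1
          (Finset.mem_powersetCard.mp (Finset.mem_coe.mp hP')).1 (add_left_cancel hPP)
      rw [Finset.card_image_of_injOn hinj, Finset.card_powersetCard]
      simp only at hT
      rw [hT, Nat.centralBinom])
    (by
      refine lt_of_le_of_lt (Nat.mul_le_mul_right _ (Finset.card_image_le.trans ?_)) h
      rw [Finset.card_product, Fintype.card_piFinset_const, Finset.card_range,
        Finset.card_powersetCard, Finset.card_univ, Fintype.card_fin]
      exact Nat.mul_le_mul_left _ (Nat.choose_le_pow _ _))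
  refine ⟨fun A => decide (powerSums (2 * p) A ∈ U), fun S T hST hT b => ?_⟩
  have hmem : E (powerSums (2 * p) S, T) ∈ I.image E := by
    refine Finset.mem_image_of_mem _ (Finset.mem_product.mpr ⟨?_, ?_⟩)
    · exact Fintype.mem_piFinset.mpr fun j =>
        Finset.mem_range.mpr (Nat.lt_succ_of_le (powerSums_le S j))
    · exact Finset.mem_powersetCard.mpr ⟨Finset.subset_univ _, hT⟩
  obtain ⟨⟨x, hx, hxU⟩, y, hy, hyU⟩ := hU _ hmem
  obtain ⟨P, hP, rfl⟩ := Finset.mem_image.mp hx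
  obtain ⟨P', hP', rfl⟩ := Finset.mem_image.mp hy
  rw [Finset.mem_powersetCard] at hP hP'
  simp only at hP hP' hxU hyU
  rw [← powerSums_union (hST.mono_right hP.1)] at hxU
  rw [← powerSums_union (hST.mono_right hP'.1)] at hyU
  cases b
  · exact ⟨P', hP'.1, hP'.2, by simpa using hyU⟩
  · exact ⟨P, hP.1, hP.2, by simpa using hxU⟩

theorem two_mul_mul_sq_lt_two_pow {p : ℕ} (hp : 16 ≤ p) : 2 * p * (2 * p + 1) ^ 2 < 2 ^ p := by
  induction p, hp using Nat.le_induction with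
  | base => norm_num
  | succ p hp ih =>
    have : 2 * (p + 1) * (2 * (p + 1) + 1) ^ 2 ≤ 2 * (2 * p * (2 * p + 1) ^ 2) := by
      obtain ⟨k, rfl⟩ := Nat.exists_eq_add_of_le hp
      ring_nf
      nlinarith [sq_nonneg k, pow_nonneg (Nat.zero_le k) 3]
    calc 2 * (p + 1) * (2 * (p + 1) + 1) ^ 2 ≤ 2 * (2 * p * (2 * p + 1) ^ 2) := this
      _ < 2 * 2 ^ p := Nat.mul_lt_mul_of_pos_left ih two_pos
      _ = 2 ^ (p + 1) := (pow_succ' 2 p).symm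

/-- In base-2 logarithms, the left side is at most `L` times a polynomial in `p`, hence `2 ^ p`
times one, against at least `4 ^ p / (2p)`; `16 ≤ p` lets `2 ^ p` beat the polynomial. -/
theorem daisy_union_bound {p L : ℕ} (hp : 16 ≤ p) (hn : n ≤ 2 ^ L) (hL : L ≤ 2 ^ p) :
    (n ^ (2 * p) + 1) ^ (2 * p) * n ^ (2 * p) * 2 < 2 ^ p.centralBinom := by
  have h1 : n ^ (2 * p) ≤ 2 ^ (L * (2 * p)) := by
    rw [pow_mul 2 L]; exact Nat.pow_le_pow_left hn _
  have h2 : n ^ (2 * p) + 1 ≤ 2 ^ (L * (2 * p) + 1) := by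
    have := Nat.one_le_two_pow (n := L * (2 * p))
    rw [pow_succ]; omega
  have h3 : 2 * p * ((L * (2 * p) + 1) * (2 * p) + L * (2 * p) + 1) < 2 * p * p.centralBinom := by
    refine lt_of_lt_of_le ?_ (Nat.four_pow_le_two_mul_self_mul_centralBinom p (by omega))
    calc 2 * p * ((L * (2 * p) + 1) * (2 * p) + L * (2 * p) + 1)
        = 2 * p * (L * (2 * p) * (2 * p + 1) + (2 * p + 1)) := by ring
      _ ≤ 2 * p * (2 ^ p * (2 * p) * (2 * p + 1) + 2 ^ p * (2 * p + 1)) := by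
          gcongr
          exact Nat.le_mul_of_pos_left _ (by positivity)
      _ = 2 ^ p * (2 * p * (2 * p + 1) ^ 2) := by ring
      _ < 2 ^ p * 2 ^ p := Nat.mul_lt_mul_of_pos_left (two_mul_mul_sq_lt_two_pow hp) (by positivity)
      _ = 4 ^ p := by rw [← mul_pow]; norm_num
  calc (n ^ (2 * p) + 1) ^ (2 * p) * n ^ (2 * p) * 2
      ≤ (2 ^ (L * (2 * p) + 1)) ^ (2 * p) * 2 ^ (L * (2 * p)) * 2 := by gcongr
    _ = 2 ^ ((L * (2 * p) + 1) * (2 * p) + L * (2 * p) + 1) := by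
        rw [← pow_mul, ← pow_add, ← pow_succ]
    _ < 2 ^ p.centralBinom := Nat.pow_lt_pow_right (by norm_num) (Nat.lt_of_mul_lt_mul_left h3)

end Daisies

/-! ### Upper bound -/

section UpperBound

variable {n p : ℕ} {M : Set (Finset (Fin n))} {u v : Finset (Fin n)}

theorem not_mem_strip_of_mod_eq (hM : ∀ w ∈ M, w.card % p = u.card % p) :
    ∀ w ∈ M, ¬ (u.card + 1 ≤ w.card ∧ w.card ≤ u.card + p - 1) := by
  rintro w hw ⟨h1, h2⟩
  have h3 := Nat.sub_mod_eq_zero_of_mod_eq (hM w hw)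
  rw [Nat.mod_eq_of_lt (by omega)] at h3
  omega

/-- One added element at each end enters the free strip above; `3 ≤ p` gives it two levels. -/
theorem Linked.of_card_eq (hp : 3 ≤ p) (hM : ∀ w ∈ M, w.card % p = u.card % p)
    (huv : v.card = u.card) : Linked M u v := by
  have hs := not_mem_strip_of_mod_eq hM
  by_cases hvu : v ⊆ u
  · rw [Finset.eq_of_subset_of_card_le hvu huv.ge]
    exact Linked.refl M u
  have huv' : ¬ u ⊆ v := fun h => hvu (Finset.eq_of_subset_of_card_le h huv.le).ge
  obtain ⟨x, hxv, hxu⟩ := Finset.not_subset.mp hvu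
  obtain ⟨y, hyu, hyv⟩ := Finset.not_subset.mp huv'
  have hx := Finset.card_insert_of_notMem hxu
  have hy := Finset.card_insert_of_notMem hyv
  refine Linked.of_insert hxv hxu (fun h => hs _ h (by omega)) (Linked.symm ?_)
  refine Linked.of_insert (Finset.mem_insert_of_mem hyu) hyv (fun h => hs _ h (by omega)) ?_
  exact Linked.of_mem_strip (by omega) hs _ (by omega) _ (by omega)

theorem Linked.of_card_eq_add (hp : 3 ≤ p) (hM : ∀ w ∈ M, w.card % p = u.card % p)
    (huv : v.card = u.card + p) : Linked M u v := by
  have hs := not_mem_strip_of_mod_eq hM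
  obtain ⟨x, hxv, hxu⟩ := Finset.exists_mem_notMem_of_card_lt_card (show u.card < v.card by omega)
  have hx := Finset.card_insert_of_notMem hxu
  obtain ⟨y, hyv, hyu⟩ :=
    Finset.exists_mem_notMem_of_card_lt_card (show (insert x u).card < v.card by omega)
  have hy := Finset.card_erase_of_mem hyv
  refine Linked.of_insert hxv hxu (fun h => hs _ h (by omega)) (Linked.symm ?_)
  refine Linked.of_erase hyv hyu (fun h => hs _ h (by omega)) ?_
  exact Linked.of_mem_strip (by omega) hs _ (by omega) _ (by omega)

/-- If `M` lies in levels that are congruent mod `p` and contains no full daisy, then any two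
vertices in such levels are linked. -/
theorem Linked.of_daisy_free (hp : 3 ≤ p)
    (hd : ∀ S T : Finset (Fin n), Disjoint S T → T.card = 2 * p →
      ∃ P ⊆ T, P.card = p ∧ S ∪ P ∉ M) (j : ℕ) :
    ∀ u : Finset (Fin n), (∀ w ∈ M, w.card % p = u.card % p) → v.card = u.card + p * j →
      Linked M u v := by
  induction j with
  | zero => exact fun u hM huv => Linked.of_card_eq hp hM (by simpa using huv)
  | succ j ih =>
    intro u hM huv
    rcases j.eq_zero_or_pos with rfl | hj
    · exact Linked.of_card_eq_add hp hM (by simpa using huv)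
    -- With at least two periods left, `v \ u` has room for a `2p`-set.
    have hlarge : 2 * p ≤ (v \ u).card := by
      have h1 := Finset.le_card_sdiff u v
      have h2 : p * 2 ≤ p * (j + 1) := Nat.mul_le_mul_left p (by omega)
      omega
    obtain ⟨T, hTv, hTc⟩ := Finset.exists_subset_card_eq hlarge
    have huT : Disjoint u T := Finset.disjoint_sdiff.mono_right hTv
    obtain ⟨P, hPT, hPc, hPM⟩ := hd u T huT hTc
    have hc : (u ∪ P).card = u.card + p := by
      rw [Finset.card_union_of_disjoint (huT.mono_right hPT), hPc]
    refine (Linked.of_card_eq_add hp hM hc).trans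
      (ih (u ∪ P) (fun w hw => ?_) ?_) hPM ?_
    · rw [hc, Nat.add_mod_right]; exact hM w hw
    · rw [hc, huv]; ring
    · have hPv := hPT.trans hTv
      rw [← Finset.card_union_of_disjoint]
      · congr 1
        ext a
        have h1 := @hPv a
        simp only [Finset.mem_union, Finset.mem_symmDiff, Finset.mem_sdiff] at h1 ⊢
        tauto
      · rw [Finset.disjoint_left]
        intro a
        have h1 := @hPv a
        simp only [Finset.mem_union, Finset.mem_symmDiff, Finset.mem_sdiff] at h1 ⊢
        tauto

theorem isColorable_hypercube (hp : 3 ≤ p)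
    (h : (n ^ (2 * p) + 1) ^ (2 * p) * n ^ (2 * p) * 2 < 2 ^ p.centralBinom) :
    IsColorable (hypercube n) (p * 2) := by
  obtain ⟨f, hf⟩ := exists_daisy_coloring h
  let e : Fin p × Bool ≃ Fin (p * 2) := Fintype.equivFinOfCardEq (by simp)
  refine ⟨fun w => e (⟨w.card % p, Nat.mod_lt _ (by omega)⟩, f w), fun i => ?_⟩
  obtain ⟨⟨a, b⟩, rfl⟩ := e.surjective i
  have key : ∀ u v : Finset (Fin n), u.card % p = a → v.card % p = a → u.card ≤ v.card →
      Linked {w | e (⟨w.card % p, Nat.mod_lt _ (by omega)⟩, f w) = e (a, b)} u v := by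
    intro u v hu hv huv
    obtain ⟨j, hj⟩ := Nat.dvd_of_mod_eq_zero (Nat.sub_mod_eq_zero_of_mod_eq (hv.trans hu.symm))
    refine Linked.of_daisy_free hp (fun S T hST hT => ?_) j u (fun w hw => ?_) (by omega)
    · obtain ⟨P, hPT, hPc, hPb⟩ := hf S T hST hT b
      refine ⟨P, hPT, hPc, fun hmem => hPb ?_⟩
      exact (Prod.mk.inj (e.injective hmem)).2
    · rw [hu]
      exact congrArg Fin.val (Prod.mk.inj (e.injective hw)).1
  intro u hu v hv
  have hu' : u.card % p = a := congrArg Fin.val (Prod.mk.inj (e.injective hu)).1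
  have hv' : v.card % p = a := congrArg Fin.val (Prod.mk.inj (e.injective hv)).1
  rcases le_total u.card v.card with huv | hvu
  · exact (key u v hu' hv' huv).visible
  · exact (key v u hv' hu' hvu).symm.visible

/-- Here `p = clog (clog n) + 16`, so that `clog n ≤ 2 ^ p` and `16 ≤ p`. -/
theorem chromaticNumber_hypercube_le (n : ℕ) :
    chromaticNumber (hypercube n) ≤ (Nat.clog 2 (Nat.clog 2 n) + 16) * 2 := by
  refine (isLeast_chromaticNumber (hypercube n)).2 (isColorable_hypercube (by omega) ?_)
  refine daisy_union_bound (by omega) (Nat.le_pow_clog one_lt_two n) ?_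
  exact (Nat.le_pow_clog one_lt_two _).trans (Nat.pow_le_pow_right two_pos (Nat.le_add_right _ _))

/-- The factor `2` absorbs `1 / log 2`. -/
theorem clog_two_le (x : ℕ) : (Nat.clog 2 x : ℝ) ≤ 2 * Real.log x + 1 := by
  rcases Nat.lt_or_ge 1 x with hx | hx
  · have h1 : ((2 : ℝ)) ^ (Nat.clog 2 x - 1) < x := by
      exact_mod_cast Nat.pow_pred_clog_lt_self one_lt_two hx
    have h2 := Real.log_le_log (by positivity) h1.le
    rw [Real.log_pow, Nat.cast_sub (Nat.clog_pos one_lt_two hx), Nat.cast_one] at h2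
    have h3 : (1 : ℝ) ≤ Nat.clog 2 x := by exact_mod_cast Nat.clog_pos one_lt_two hx
    have h4 := Real.log_two_gt_d9
    nlinarith
  · rw [Nat.clog_of_right_le_one hx]
    have := Real.log_natCast_nonneg x
    push_cast
    linarith

theorem clog_clog_le {n : ℕ} (hn : 1 ≤ Real.log n) :
    (Nat.clog 2 (Nat.clog 2 n) : ℝ) ≤ 2 * Real.log (Real.log n) + 5 := by
  have hn1 : 1 < n := by
    by_contra! h
    interval_cases n <;> norm_num at hn
  have hL : (0 : ℝ) < Nat.clog 2 n := by exact_mod_cast Nat.clog_pos one_lt_two hn1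
  have h1 : (Nat.clog 2 n : ℝ) ≤ 3 * Real.log n := by linarith [clog_two_le n]
  have h2 := Real.log_le_log hL h1
  rw [Real.log_mul (by norm_num) (by linarith)] at h2
  have h3 : Real.log 3 ≤ 2 := by
    have := Real.log_le_sub_one_of_pos (show (0 : ℝ) < 3 by norm_num); linarith
  linarith [clog_two_le (Nat.clog 2 n)]

theorem isBigO_chromaticNumber_hypercube :
    (fun n : ℕ => (chromaticNumber (hypercube n) : ℝ)) =O[atTop]
      (fun n : ℕ => Real.log (Real.log (n : ℝ))) := by
  have hlog : Tendsto (fun n : ℕ => Real.log (n : ℝ)) atTop atTop :=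
    Real.tendsto_log_atTop.comp tendsto_natCast_atTop_atTop
  -- `2 * (2 * log log n + 5 + 16) ≤ 46 * log log n` once `log log n ≥ 1`.
  refine IsBigO.of_bound 46 ?_
  filter_upwards [hlog.eventually_ge_atTop 1,
    (Real.tendsto_log_atTop.comp hlog).eventually_ge_atTop 1] with n h1 h2
  have h2' : 1 ≤ Real.log (Real.log n) := h2
  have h3 : (chromaticNumber (hypercube n) : ℝ) ≤ (Nat.clog 2 (Nat.clog 2 n) + 16) * 2 := by
    exact_mod_cast chromaticNumber_hypercube_le n
  rw [Real.norm_of_nonneg (Nat.cast_nonneg _), Real.norm_of_nonneg (by linarith)]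
  linarith [clog_clog_le h1]

end UpperBound

end MutualVisibility

theorem theorem3 :
    Tendsto (fun n : ℕ => MutualVisibility.chromaticNumber (MutualVisibility.hypercube n))
        atTop atTop ∧
      (fun n : ℕ => (MutualVisibility.chromaticNumber (MutualVisibility.hypercube n) : ℝ))
        =O[atTop] (fun n : ℕ => Real.log (Real.log (n : ℝ))) ∧
      ¬ ∃ C : ℝ, 0 < C ∧ ∀ n : ℕ, 1 ≤ n →
        (MutualVisibility.chromaticNumber (MutualVisibility.hypercube n) : ℝ) ≤ C := by
  refine ⟨MutualVisibility.tendsto_chromaticNumber_hypercube,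
    MutualVisibility.isBigO_chromaticNumber_hypercube, ?_⟩
  rintro ⟨C, -, hC⟩
  have h := tendsto_natCast_atTop_atTop (R := ℝ) |>.comp
    MutualVisibility.tendsto_chromaticNumber_hypercube
  obtain ⟨n, hn, hn1⟩ := ((h.eventually_gt_atTop C).and (eventually_ge_atTop 1)).exists
  exact absurd (hC n hn1) (not_le.mpr hn)
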